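/- A \emph{planar instance} $(G,T)$ is a finite connected simple plane graph $G$ with nonnegative edge weights, together with a set $T\subseteq V(G)$ of \emph{terminals}; $\mathrm{dist}_G$ denotes the shortest-path distance. It is a \emph{one-hole instance} if all terminals lie on the outer face of $G$. For $\varepsilon\in(0,1)$, an instance $(G',T)$ with the same set of terminals is an \emph{$\varepsilon$-emulator} for $(G,T)$ if \[ e^{-\varepsilon}\cdot \mathrm{dist}_G(x,y)\le \mathrm{dist}_{G'}(x,y)\le e^{\varepsilon}\cdot \mathrm{dist}_G(x,y)\qquad\text{for all } x,y\in T. \] An $\varepsilon$-emulator $(G',T)$ for a one-hole instance $(G,T)$ is \emph{aligned} if $(G',T)$ is also a one-hole instance and the circular orderings of the terminals on the outer faces of $G$ and $G'$ are identical (if a terminal occurs more than once on the boundary walk of an outer face, it is enough that occurrences of the terminals can be chosen so that the orderings agree). \textbf{Theorem.} There is an absolute constant $c>0$ such that for every integer $k\ge 2$ and every real $\varepsilon$ with $4/k<\varepsilon<1$ there is a one-hole instance $(G,T)$ with $|T|=k$ and positive edge weights, such that every aligned $\varepsilon$-emulator $(G',T)$ for $(G,T)$ has $|V(G')|\ge c\cdot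 k/\varepsilon$. -/

import Mathlib

/-- A connected plane graph on the finite vertex set `V`: a connected simple graph, given with a
combinatorial embedding (rotation system) of genus zero and a choice of the outer face.
A dart is an edge with an orientation. (The graph with one vertex, which has no dart, is not
covered.) -/
structure PlaneGraph (V : Type*) [Fintype V] where
  /-- the underlying simple undirected graph -/
  graph : SimpleGraph V
  connected : graph.Connected
  /-- the rotation system: the next dart, in clockwise order, with the same tail -/
  rot : Equiv.Perm graph.Dart
  rot_fst : ∀ d, (rot d).fst = d.fst
  /-- the darts that leave a vertex form a single cycle of the rotation -/
  rot_cyclic : ∀ d d', d.fst = d'.fst → rot.SameCycle d d'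
  /-- Euler's formula `|V| - |E| + |F| = 2`. The faces are the orbits of the map that sends a dart
  from `u` to `v` to the rotation successor of the reverse dart from `v` to `u`. -/
  euler : (Fintype.card V : ℤ) - (Nat.card graph.edgeSet : ℤ) +
    (Nat.card (Quotient (Equiv.Perm.SameCycle.setoid
      ((SimpleGraph.Dart.symm_involutive.toPerm
        (SimpleGraph.Dart.symm : graph.Dart → graph.Dart)).trans rot))) : ℤ) = 2
  /-- a dart of the boundary walk of the outer face -/
  outer : graph.Dart

namespace PlaneGraph

variable {V : Type*} [Fintype V] (G : PlaneGraph V)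

/-- One step along the boundary walk of a face: `d` from `u` to `v` is followed by the rotation
successor of the reverse of `d`, a dart that leaves `v`. -/
def faceNext : Equiv.Perm G.graph.Dart :=
  (SimpleGraph.Dart.symm_involutive.toPerm
    (SimpleGraph.Dart.symm : G.graph.Dart → G.graph.Dart)).trans G.rot

/-- The vertex `v` lies on the outer face. -/
def OnOuterFace (v : V) : Prop :=
  ∃ d : G.graph.Dart, G.faceNext.SameCycle G.outer d ∧ d.fst = v

/-- The vertices `v 0, …, v (k - 1)` occur in this circular order on the outer face: in one round
along the boundary walk of the outer face, started at a suitable dart `d`, one can choose an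
occurrence of each `v i` so that these occurrences come in the order `0, 1, …, k - 1`.
(A cut vertex may occur several times on the boundary walk.) -/
def IsOuterOrder {k : ℕ} (v : Fin k → V) : Prop :=
  ∃ d : G.graph.Dart, G.faceNext.SameCycle G.outer d ∧
    ∃ p : Fin k → ℕ, StrictMono p ∧
      ∀ i, p i < Function.minimalPeriod G.faceNext d ∧ ((G.faceNext ^ p i) d).fst = v i

end PlaneGraph

/-- A planar instance `(G, T)` with nonnegative edge weights: `T` is the set of terminals, each of
which is a vertex. Only the weights of edges matter. -/
structure PlanarInstance (T V : Type*) [Fintype V] extends PlaneGraph V where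
  weight : Sym2 V → ℝ
  weight_nonneg : ∀ e ∈ graph.edgeSet, 0 ≤ weight e
  /-- the terminals as vertices of the graph -/
  terminal : T ↪ V

namespace PlanarInstance

variable {T V V' : Type*} [Fintype V] [Fintype V']

/-- The shortest-path distance. -/
noncomputable def dist (G : PlanarInstance T V) (u v : V) : ℝ :=
  ⨅ p : G.graph.Walk u v, (p.edges.map G.weight).sum

/-- A one-hole instance: all terminals lie on the outer face. -/
def IsOneHole (G : PlanarInstance T V) : Prop :=
  ∀ t, G.toPlaneGraph.OnOuterFace (G.terminal t)

/-- `H` is an `ε`-emulator for `G` (with respect to the common set `T` of terminals). -/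
def IsEmulator (ε : ℝ) (H : PlanarInstance T V') (G : PlanarInstance T V) : Prop :=
  ∀ x y : T,
    Real.exp (-ε) * G.dist (G.terminal x) (G.terminal y) ≤
        H.dist (H.terminal x) (H.terminal y) ∧
      H.dist (H.terminal x) (H.terminal y) ≤
        Real.exp ε * G.dist (G.terminal x) (G.terminal y)

/-- The terminals have a common circular ordering on the outer faces of `H` and `G`. -/
def SameOuterOrder [Fintype T] (H : PlanarInstance T V') (G : PlanarInstance T V) : Prop :=
  ∃ σ : Fin (Fintype.card T) ≃ T,
    G.toPlaneGraph.IsOuterOrder (fun i => G.terminal (σ i)) ∧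
      H.toPlaneGraph.IsOuterOrder (fun i => H.terminal (σ i))

/-- `H` is an aligned `ε`-emulator for `G`. -/
def IsAlignedEmulator [Fintype T] (ε : ℝ) (H : PlanarInstance T V')
    (G : PlanarInstance T V) : Prop :=
  IsEmulator ε H G ∧ H.IsOneHole ∧ SameOuterOrder H G

end PlanarInstance

/-! The instance is a grid with `2 * m` by `2 * q` cells, where `m = k / 2` and `q` is of order `1 /
ε`, weighted by the differences of a potential so that staircases of slope `1` and `-1` from the
lower to the upper side are shortest paths of length `4 * q`. They form two families, shifted by `q`
terminals to the right or to the left.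

In an aligned emulator every staircase is replaced by a nearly shortest walk. Two walks of one
family cannot meet: exchanging their ends at a common vertex would give two walks of total length
below `exp (-ε) * (8 * q + 2)`, while the exchanged pairs have distance sum at least `8 * q + 2` in
the grid (`le_dist_add_dist`); `q` is small enough for the distortion not to hide the gap `2`. Walks
of opposite families whose ends alternate on the outer face must meet, by planarity. The meeting
vertices are therefore distinct for distinct pairs, and there are `(m - 2 * q) * q` pairs, of order
`k / ε`.

The planarity argument (`exists_mem_support_of_alternating`) is homological: in genus zero every
cycle modulo two is a sum of face boundaries, by counting dimensions in Euler's formula. The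
dimension inequality `card_add_card_face_le`, valid in every genus, also proves that the grid is
planar. -/

/-! ### Rotation systems and their homology modulo two -/

/-- A connected graph with a rotation system, of arbitrary genus. -/
structure RotationSystem (V : Type*) where
  graph : SimpleGraph V
  connected : graph.Connected
  rot : Equiv.Perm graph.Dart
  rot_fst : ∀ d, (rot d).fst = d.fst
  rot_cyclic : ∀ d d', d.fst = d'.fst → rot.SameCycle d d'

namespace RotationSystem

open Module SimpleGraph

open scoped Classical

noncomputable section

variable {V : Type*} (M : RotationSystem V)

/-- One step along the boundary walk of a face. -/
def faceNext : Equiv.Perm M.graph.Dart :=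
  (SimpleGraph.Dart.symm_involutive.toPerm
    (SimpleGraph.Dart.symm : M.graph.Dart → M.graph.Dart)).trans M.rot

theorem faceNext_apply (d : M.graph.Dart) : M.faceNext d = M.rot d.symm := rfl

theorem faceNext_fst (d : M.graph.Dart) : (M.faceNext d).fst = d.snd := M.rot_fst _

theorem rot_eq_faceNext_symm (d : M.graph.Dart) : M.rot d = M.faceNext d.symm := by
  rw [faceNext_apply, Dart.symm_symm]

/-- The faces: the orbits of `faceNext`. -/
abbrev Face : Type _ := Quotient (Equiv.Perm.SameCycle.setoid M.faceNext)

/-- The face on whose boundary walk a dart lies. -/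
def face (d : M.graph.Dart) : M.Face := Quotient.mk _ d

theorem face_eq_iff {d d' : M.graph.Dart} : M.face d = M.face d' ↔ M.faceNext.SameCycle d d' :=
  Quotient.eq

theorem face_faceNext (d : M.graph.Dart) : M.face (M.faceNext d) = M.face d :=
  M.face_eq_iff.2 (Equiv.Perm.sameCycle_apply_left.2 (Equiv.Perm.SameCycle.refl _ _))

variable {M} in
/-- A function of the darts that is invariant under the rotation at the vertices of `S`, and under
reversal of the darts inside `S`, is constant along walks inside `S`. -/
theorem eq_of_walk {α : Type*} (h : M.graph.Dart → α) (S : Set V)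
    (hrot : ∀ d, d.fst ∈ S → h (M.rot d) = h d)
    (hsymm : ∀ d, d.fst ∈ S → d.snd ∈ S → h d.symm = h d)
    {u v : V} (p : M.graph.Walk u v) (hp : ∀ x ∈ p.support, x ∈ S) (d d' : M.graph.Dart)
    (hd : d.fst = u) (hd' : d'.fst = v) : h d = h d' := by
  have key : ∀ e e' : M.graph.Dart, e.fst ∈ S → e.fst = e'.fst → h e = h e' := by
    intro e e' he hee
    obtain ⟨n, hn⟩ := M.rot_cyclic e e' hee
    have hz : ∀ n : ℤ, ((M.rot ^ n) e).fst = e.fst ∧ h ((M.rot ^ n) e) = h e := by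
      intro n
      induction n using Int.induction_on with
      | zero => simp
      | succ i ih =>
        have : (M.rot ^ ((i : ℤ) + 1)) e = M.rot ((M.rot ^ (i : ℤ)) e) := by
          rw [add_comm, zpow_add, zpow_one, Equiv.Perm.mul_apply]
        rw [this, M.rot_fst, hrot _ (ih.1 ▸ he)]
        exact ih
      | pred i ih =>
        have : (M.rot ^ (-(i : ℤ))) e = M.rot ((M.rot ^ (-(i : ℤ) - 1)) e) := by
          rw [← Equiv.Perm.mul_apply, ← zpow_one_add]; congr 2; ring
        rw [this, M.rot_fst] at ih
        rw [hrot _ (ih.1 ▸ he)] at ih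
        exact ih
    rw [← hn]
    exact (hz n).2.symm
  induction p generalizing d with
  | nil => exact key d d' (hd ▸ hp _ (by simp)) (hd.trans hd'.symm)
  | @cons a b c hab p ih =>
    have ha : a ∈ S := hp _ (by simp)
    have hb : b ∈ S := hp _ (by simp)
    let e : M.graph.Dart := ⟨(a, b), hab⟩
    calc h d = h e := key d e (hd ▸ ha) hd
      _ = h e.symm := (hsymm e ha hb).symm
      _ = h d' := ih (fun x hx => hp x (by simp [hx])) e.symm rfl hd'

/-- The edge of a dart. -/
def edge (d : M.graph.Dart) : M.graph.edgeSet := ⟨d.edge, d.edge_mem⟩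

theorem edge_eq_iff {d d' : M.graph.Dart} : M.edge d = M.edge d' ↔ d = d' ∨ d = d'.symm := by
  rw [← dart_edge_eq_iff, edge, edge, Subtype.mk.injEq]

/-- The edges of a walk, counted modulo two. -/
def walkChain {u v : V} (p : M.graph.Walk u v) : M.graph.edgeSet → ZMod 2 :=
  fun e => (p.edges.count e.1 : ZMod 2)

theorem walkChain_eq_zero {u v : V} (p : M.graph.Walk u v) (d : M.graph.Dart)
    (hd : d.fst ∉ p.support) : M.walkChain p (M.edge d) = 0 := by
  have : p.edges.count (M.edge d).1 = 0 :=
    List.count_eq_zero.2 fun h => hd (p.fst_mem_support_of_mem_edges h)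
  rw [walkChain, this, Nat.cast_zero]

theorem add_self_zmod_two {α : Type*} (f : α → ZMod 2) : f + f = 0 :=
  funext fun _ => CharTwo.add_self_eq_zero _

variable [Fintype V]

theorem finite_face : Finite M.Face := inferInstanceAs (Finite (Quotient _))

/-- The boundary map from edges to vertices, modulo two. -/
def vertexBoundary : (M.graph.edgeSet → ZMod 2) →ₗ[ZMod 2] (V → ZMod 2) where
  toFun c v := ∑ d : M.graph.Dart, if d.fst = v then c (M.edge d) else 0
  map_add' c c' := by
    ext v
    simp only [Pi.add_apply, ← Finset.sum_add_distrib]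
    exact Finset.sum_congr rfl fun d _ => by split_ifs <;> simp
  map_smul' a c := by
    ext v
    simp only [Pi.smul_apply, smul_eq_mul, Finset.mul_sum, RingHom.id_apply]
    exact Finset.sum_congr rfl fun d _ => by split_ifs <;> simp

/-- The boundary map from faces to edges, modulo two. -/
def edgeBoundary : (M.Face → ZMod 2) →ₗ[ZMod 2] (M.graph.edgeSet → ZMod 2) where
  toFun f e := ∑ d : M.graph.Dart, if M.edge d = e then f (M.face d) else 0
  map_add' c c' := by
    ext v
    simp only [Pi.add_apply, ← Finset.sum_add_distrib]
    exact Finset.sum_congr rfl fun d _ => by split_ifs <;> simp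
  map_smul' a c := by
    ext v
    simp only [Pi.smul_apply, smul_eq_mul, Finset.mul_sum, RingHom.id_apply]
    exact Finset.sum_congr rfl fun d _ => by split_ifs <;> simp

/-- A sum over the two darts of an edge. -/
theorem sum_edge_fiber {R : Type*} [AddCommMonoid R] (g : M.graph.Dart → R) (d : M.graph.Dart) :
    (∑ d', if M.edge d' = M.edge d then g d' else 0) = g d + g d.symm := by
  rw [← Finset.sum_filter]
  have : (Finset.univ.filter fun d' => M.edge d' = M.edge d) = {d, d.symm} := by
    ext d'
    simp [edge_eq_iff]
  rw [this, Finset.sum_pair d.symm_ne.symm]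

theorem edgeBoundary_edge (f : M.Face → ZMod 2) (d : M.graph.Dart) :
    M.edgeBoundary f (M.edge d) = f (M.face d) + f (M.face d.symm) :=
  M.sum_edge_fiber (fun d' => f (M.face d')) d

/-- A dart `d` at `v` contributes the values of its face and of the face of `d.symm`, which is also
the face of `rot d`. Since `rot` permutes the darts at `v`, each value is counted twice. -/
theorem vertexBoundary_edgeBoundary (f : M.Face → ZMod 2) :
    M.vertexBoundary (M.edgeBoundary f) = 0 := by
  ext v
  change (∑ d : M.graph.Dart, if d.fst = v then M.edgeBoundary f (M.edge d) else 0) = 0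
  have h1 : ∀ d : M.graph.Dart, (if d.fst = v then M.edgeBoundary f (M.edge d) else 0) =
      (if d.fst = v then f (M.face d) else 0) +
        (if (M.rot d).fst = v then f (M.face (M.rot d)) else 0) := by
    intro d
    rw [M.rot_fst, edgeBoundary_edge, M.rot_eq_faceNext_symm, face_faceNext]
    split_ifs <;> simp
  rw [Finset.sum_congr rfl fun d _ => h1 d, Finset.sum_add_distrib,
    Equiv.sum_comp M.rot fun d => if d.fst = v then f (M.face d) else 0]
  exact CharTwo.add_self_eq_zero _

theorem vertexBoundary_single (d : M.graph.Dart) :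
    M.vertexBoundary (Pi.single (M.edge d) 1) = Pi.single d.fst 1 + Pi.single d.snd 1 := by
  ext v
  change (∑ d' : M.graph.Dart, if d'.fst = v then
    (Pi.single (M.edge d) 1 : M.graph.edgeSet → ZMod 2) (M.edge d') else 0) = _
  have h1 : ∀ d' : M.graph.Dart, (if d'.fst = v then
      (Pi.single (M.edge d) 1 : M.graph.edgeSet → ZMod 2) (M.edge d') else 0) =
      if M.edge d' = M.edge d then (if d'.fst = v then 1 else 0) else 0 := by
    intro d'
    simp only [Pi.single_apply]
    split_ifs <;> rfl
  rw [Finset.sum_congr rfl fun d _ => h1 d, sum_edge_fiber]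
  simp [Pi.single_apply, eq_comm]

theorem vertexBoundary_walkChain {u v : V} (p : M.graph.Walk u v) :
    M.vertexBoundary (M.walkChain p) = Pi.single u 1 + Pi.single v 1 := by
  induction p with
  | @nil a =>
    have : M.walkChain (Walk.nil : M.graph.Walk a a) = 0 := by
      ext e; simp [walkChain]
    rw [this, map_zero, add_self_zmod_two]
  | @cons a b c hab p ih =>
    let d : M.graph.Dart := ⟨(a, b), hab⟩
    have : M.walkChain (Walk.cons hab p) = Pi.single (M.edge d) 1 + M.walkChain p := by
      ext e
      have he : (s(a, b) = e.1) ↔ e = M.edge d := by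
        rw [Subtype.ext_iff, eq_comm]; rfl
      simp only [walkChain, Walk.edges_cons, List.count_cons, beq_iff_eq, he, Pi.add_apply,
        Pi.single_apply]
      split_ifs <;> simp [add_comm]
    rw [this, map_add, vertexBoundary_single, ih]
    change Pi.single a 1 + Pi.single b 1 + (Pi.single b 1 + Pi.single c 1) = _
    rw [add_assoc, ← add_assoc (Pi.single b 1), add_self_zmod_two, zero_add]

/-- A walk from `v` to a fixed root `r` puts the sum of the two point masses in the range, so the
range and the mass at `r` together span everything. -/
theorem finrank_range_vertexBoundary :
    Fintype.card V ≤ finrank (ZMod 2) (LinearMap.range M.vertexBoundary) + 1 := by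
  obtain ⟨r⟩ := M.connected.nonempty
  have htop : LinearMap.range M.vertexBoundary ⊔ Submodule.span (ZMod 2) {Pi.single r 1} = ⊤ := by
    rw [eq_top_iff, ← (Pi.basisFun (ZMod 2) V).span_eq, Submodule.span_le]
    rintro _ ⟨v, rfl⟩
    obtain ⟨p⟩ := M.connected.preconnected v r
    rw [Pi.basisFun_apply]
    have h : (Pi.single v 1 : V → ZMod 2) = (Pi.single v 1 + Pi.single r 1) + Pi.single r 1 := by
      rw [add_assoc, add_self_zmod_two, add_zero]
    rw [h, SetLike.mem_coe]
    refine Submodule.add_mem_sup ?_ (Submodule.mem_span_singleton_self _)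
    rw [← M.vertexBoundary_walkChain p]
    exact LinearMap.mem_range_self _ _
  have h1 := Submodule.finrank_add_le_finrank_add_finrank (LinearMap.range M.vertexBoundary)
    (Submodule.span (ZMod 2) {(Pi.single r 1 : V → ZMod 2)})
  have h2 := finrank_span_le_card (R := ZMod 2) ({Pi.single r 1} : Set (V → ZMod 2))
  rw [htop, finrank_top, finrank_fintype_fun_eq_card] at h1
  simp only [Set.toFinset_singleton, Finset.card_singleton] at h2
  omega

/-- A function in the kernel takes equal values on both sides of each edge, hence is constant by
connectedness. -/
theorem finrank_ker_edgeBoundary : finrank (ZMod 2) (LinearMap.ker M.edgeBoundary) ≤ 1 := by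
  have hle : LinearMap.ker M.edgeBoundary ≤
      Submodule.span (ZMod 2) {(fun _ => 1 : M.Face → ZMod 2)} := by
    intro f hf
    rw [LinearMap.mem_ker] at hf
    have hsymm : ∀ d, f (M.face d.symm) = f (M.face d) := by
      intro d
      have := congr_fun hf (M.edge d)
      rw [edgeBoundary_edge] at this
      exact (CharTwo.add_eq_zero.1 this).symm
    have hconst : ∀ d d', f (M.face d) = f (M.face d') := by
      intro d d'
      obtain ⟨p⟩ := M.connected.preconnected d.fst d'.fst
      refine eq_of_walk (fun d => f (M.face d)) Set.univ (fun d _ => ?_) (fun d _ _ => hsymm d) p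
        (fun _ _ => trivial) d d' rfl rfl
      simp only [rot_eq_faceNext_symm, face_faceNext, hsymm]
    rw [Submodule.mem_span_singleton]
    by_cases hne : Nonempty M.graph.Dart
    · obtain ⟨d⟩ := hne
      refine ⟨f (M.face d), ?_⟩
      ext x
      obtain ⟨d', rfl⟩ := Quotient.exists_rep x
      simpa using! hconst d d'
    · refine ⟨0, ?_⟩
      ext x
      obtain ⟨d', rfl⟩ := Quotient.exists_rep x
      exact absurd ⟨d'⟩ hne
  have h2 := finrank_span_le_card (R := ZMod 2) ({fun _ => 1} : Set (M.Face → ZMod 2))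
  simp only [Set.toFinset_singleton, Finset.card_singleton] at h2
  exact (Submodule.finrank_mono hle).trans h2

theorem range_edgeBoundary_le :
    LinearMap.range M.edgeBoundary ≤ LinearMap.ker M.vertexBoundary := by
  rintro _ ⟨f, rfl⟩
  exact M.vertexBoundary_edgeBoundary f

/-- The Euler characteristic of a connected surface map is at most two. -/
theorem card_add_card_face_le :
    Fintype.card V + Nat.card M.Face ≤ Nat.card M.graph.edgeSet + 2 := by
  have h1 := M.finrank_range_vertexBoundary
  have h2 := M.finrank_ker_edgeBoundary
  have h3 := Submodule.finrank_mono M.range_edgeBoundary_le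
  have h4 := M.vertexBoundary.finrank_range_add_finrank_ker
  have h5 := M.edgeBoundary.finrank_range_add_finrank_ker
  rw [finrank_fintype_fun_eq_card, ← Nat.card_eq_fintype_card] at h4 h5
  omega

/-- In genus zero, every cycle is a sum of face boundaries. -/
theorem exists_edgeBoundary_eq
    (euler : Fintype.card V + Nat.card M.Face = Nat.card M.graph.edgeSet + 2)
    {c : M.graph.edgeSet → ZMod 2} (hc : M.vertexBoundary c = 0) :
    ∃ f, M.edgeBoundary f = c := by
  have h1 := M.finrank_range_vertexBoundary
  have h2 := M.finrank_ker_edgeBoundary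
  have h4 := M.vertexBoundary.finrank_range_add_finrank_ker
  have h5 := M.edgeBoundary.finrank_range_add_finrank_ker
  rw [finrank_fintype_fun_eq_card, ← Nat.card_eq_fintype_card] at h4 h5
  -- Euler's formula leaves no room between the two dimensions, so the inclusion is an equality.
  have h : LinearMap.range M.edgeBoundary = LinearMap.ker M.vertexBoundary :=
    Submodule.eq_of_le_of_finrank_le M.range_edgeBoundary_le (by omega)
  rw [← LinearMap.mem_ker, ← h] at hc
  exact hc

end

end RotationSystem

/-! ### Walks with alternating ends on a face meet -/

theorem sum_Ico_add_succ_zmod_two (F : ℕ → ZMod 2) {a b : ℕ} (hab : a ≤ b) :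
    ∑ t ∈ Finset.Ico a b, (F t + F (t + 1)) = F a + F b := by
  induction b, hab using Nat.le_induction with
  | base => simp [CharTwo.add_self_eq_zero]
  | succ n hn ih =>
    rw [Finset.sum_Ico_succ_top hn, ih, add_assoc, ← add_assoc (F n), CharTwo.add_self_eq_zero,
      zero_add]

namespace RotationSystem

open SimpleGraph

open scoped Classical

noncomputable section

variable {V : Type*} (M : RotationSystem V)

/-- The number, modulo two, of passages of the boundary walk that starts with `d₀` through the dart
`e` at the times in `[a, b)`. -/
def passages (d₀ : M.graph.Dart) (a b : ℕ) (e : M.graph.Dart) : ZMod 2 :=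
  ∑ t ∈ Finset.Ico a b, if (M.faceNext ^ t) d₀ = e then 1 else 0

/-- A passage through `e` at time `t` is a passage through `faceNext e` at time `t + 1`; the two
counts can differ only at the ends of the time interval. -/
theorem passages_faceNext (d₀ : M.graph.Dart) {a b : ℕ} (hab : a ≤ b) (e : M.graph.Dart)
    (ha : (M.faceNext ^ a) d₀ ≠ M.faceNext e) (hb : (M.faceNext ^ b) d₀ ≠ M.faceNext e) :
    M.passages d₀ a b (M.faceNext e) = M.passages d₀ a b e := by
  rw [← CharTwo.add_eq_zero, passages, passages, ← Finset.sum_add_distrib]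
  have := sum_Ico_add_succ_zmod_two
    (fun t => if (M.faceNext ^ t) d₀ = M.faceNext e then 1 else 0) hab
  simp only [if_neg ha, if_neg hb, add_zero] at this
  refine Eq.trans ?_ this
  refine Finset.sum_congr rfl fun t _ => ?_
  simp only [pow_succ', Equiv.Perm.mul_apply, EmbeddingLike.apply_eq_iff_eq]

theorem faceNext_pow_inj {d₀ : M.graph.Dart} {s t : ℕ}
    (hs : s < Function.minimalPeriod M.faceNext d₀)
    (ht : t < Function.minimalPeriod M.faceNext d₀) :
    (M.faceNext ^ s) d₀ = (M.faceNext ^ t) d₀ ↔ s = t := by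
  rw [← Equiv.Perm.iterate_eq_pow, ← Equiv.Perm.iterate_eq_pow]
  exact Function.iterate_eq_iterate_iff_of_lt_minimalPeriod hs ht

theorem passages_pow {d₀ : M.graph.Dart} {a b s : ℕ}
    (hb : b < Function.minimalPeriod M.faceNext d₀)
    (hs : s < Function.minimalPeriod M.faceNext d₀) :
    M.passages d₀ a b ((M.faceNext ^ s) d₀) = if s ∈ Finset.Ico a b then 1 else 0 := by
  rw [passages, ← Finset.sum_ite_eq' (Finset.Ico a b) s (fun _ => (1 : ZMod 2))]
  refine Finset.sum_congr rfl fun t ht => ?_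
  rw [Finset.mem_Ico] at ht
  simp only [M.faceNext_pow_inj (ht.2.trans hb) hs]

variable [Fintype V]

/-- In a map of genus zero, two walks whose ends alternate on the boundary of a face meet. -/
theorem exists_mem_support_of_alternating
    (euler : Fintype.card V + Nat.card M.Face = Nat.card M.graph.edgeSet + 2)
    (d₀ : M.graph.Dart) {p₁ p₂ p₃ p₄ : ℕ} (h12 : p₁ < p₂) (h23 : p₂ < p₃) (h34 : p₃ < p₄)
    (h4 : p₄ < Function.minimalPeriod M.faceNext d₀) {s₁ s₂ s₃ s₄ : V}
    (e1 : ((M.faceNext ^ p₁) d₀).fst = s₁) (e2 : ((M.faceNext ^ p₂) d₀).fst = s₂)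
    (e3 : ((M.faceNext ^ p₃) d₀).fst = s₃) (e4 : ((M.faceNext ^ p₄) d₀).fst = s₄)
    (P : M.graph.Walk s₁ s₃) (Q : M.graph.Walk s₂ s₄) : ∃ x ∈ P.support, x ∈ Q.support := by
  by_contra! hdisj
  -- The arc of the face boundary from `s₁` to `s₃`; it closes `P` to a cycle.
  let W : M.graph.edgeSet → ZMod 2 :=
    ∑ t ∈ Finset.Ico p₁ p₃, Pi.single (M.edge ((M.faceNext ^ t) d₀)) 1
  have hW : M.vertexBoundary W = Pi.single s₁ 1 + Pi.single s₃ 1 := by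
    rw [map_sum]
    ext v
    have := sum_Ico_add_succ_zmod_two
      (fun t => (Pi.single ((M.faceNext ^ t) d₀).fst 1 : V → ZMod 2) v) (h12.trans h23).le
    rw [e1, e3] at this
    rw [Pi.add_apply, ← this, Finset.sum_apply]
    refine Finset.sum_congr rfl fun t _ => ?_
    rw [vertexBoundary_single, Pi.add_apply, pow_succ', Equiv.Perm.mul_apply, faceNext_fst]
  have hWe : ∀ e, W (M.edge e) = M.passages d₀ p₁ p₃ e + M.passages d₀ p₁ p₃ e.symm := by
    intro e
    rw [show W = ∑ t ∈ Finset.Ico p₁ p₃, Pi.single (M.edge ((M.faceNext ^ t) d₀)) 1 from rfl,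
      Finset.sum_apply, passages, passages, ← Finset.sum_add_distrib]
    refine Finset.sum_congr rfl fun t _ => ?_
    have h : M.edge e = M.edge ((M.faceNext ^ t) d₀) ↔
        (M.faceNext ^ t) d₀ = e ∨ (M.faceNext ^ t) d₀ = e.symm := by
      rw [eq_comm, edge_eq_iff]
    rw [Pi.single_apply]
    by_cases h1 : (M.faceNext ^ t) d₀ = e
    · have h2 : (M.faceNext ^ t) d₀ ≠ e.symm := h1 ▸ e.symm_ne.symm
      rw [if_pos (h.2 (Or.inl h1)), if_pos h1, if_neg h2, add_zero]
    · by_cases h2 : (M.faceNext ^ t) d₀ = e.symm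
      · rw [if_pos (h.2 (Or.inr h2)), if_neg h1, if_pos h2, zero_add]
      · rw [if_neg (by rw [h]; tauto), if_neg h1, if_neg h2, zero_add]
  obtain ⟨f, hf⟩ := M.exists_edgeBoundary_eq euler (c := M.walkChain P + W) (by
    rw [map_add, hW, vertexBoundary_walkChain, add_self_zmod_two])
  -- Off `P`, the function `f` jumps across an edge exactly by the multiplicity of that edge in `W`.
  -- The passages cancel this jump, so `g` is constant along every walk that avoids `P`.
  let g : M.graph.Dart → ZMod 2 := fun e => f (M.face e) + M.passages d₀ p₁ p₃ e
  have hsymm : ∀ e : M.graph.Dart, e.fst ∉ P.support → g e.symm = g e := by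
    intro e he
    have h1 := congr_fun hf (M.edge e)
    rw [edgeBoundary_edge, Pi.add_apply, M.walkChain_eq_zero P e he, hWe, zero_add] at h1
    rw [← CharTwo.add_eq_zero]
    change f (M.face e.symm) + M.passages d₀ p₁ p₃ e.symm +
      (f (M.face e) + M.passages d₀ p₁ p₃ e) = 0
    calc _ = (f (M.face e) + f (M.face e.symm)) +
          (M.passages d₀ p₁ p₃ e + M.passages d₀ p₁ p₃ e.symm) := by ring
      _ = 0 := by rw [h1, CharTwo.add_self_eq_zero]
  have hrot : ∀ e : M.graph.Dart, e.fst ∉ P.support → g (M.rot e) = g e := by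
    intro e he
    rw [← hsymm e he, rot_eq_faceNext_symm]
    change f (M.face (M.faceNext e.symm)) + _ = f (M.face e.symm) + _
    -- The exceptional darts at times `p₁` and `p₃` leave `s₁` and `s₃`, which lie on `P`.
    rw [face_faceNext, passages_faceNext _ _ (h12.trans h23).le]
    · intro h
      rw [h, faceNext_fst] at e1
      exact he (show e.fst ∈ _ by rw [show e.fst = s₁ from e1]; exact P.start_mem_support)
    · intro h
      rw [h, faceNext_fst] at e3
      exact he (show e.fst ∈ _ by rw [show e.fst = s₃ from e3]; exact P.end_mem_support)
  have key := eq_of_walk g {x | x ∉ P.support} hrot (fun d hd _ => hsymm d hd) Q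
    (fun x hx hx' => hdisj x hx' hx) _ _ e2 e4
  have hface : ∀ t : ℕ, M.face ((M.faceNext ^ t) d₀) = M.face d₀ := fun t =>
    (M.face_eq_iff.2 ⟨t, by simp⟩).symm
  change f (M.face _) + _ = f (M.face _) + _ at key
  -- Both darts lie on the same face, but only `p₂` is in `[p₁, p₃)`: the values of `g` at the two
  -- ends of `Q` differ by one.
  rw [hface, hface, M.passages_pow (h34.trans h4) ((h23.trans h34).trans h4),
    M.passages_pow (h34.trans h4) h4, if_pos (by simp; omega), if_neg (by simp; omega)] at key
  simp at key

end

end RotationSystem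

/-! ### Alternating terminals on the outer face -/

namespace PlaneGraph

variable {V : Type*} [Fintype V] (G : PlaneGraph V)

/-- The rotation system of a plane graph. -/
def toRotationSystem : RotationSystem V where
  graph := G.graph
  connected := G.connected
  rot := G.rot
  rot_fst := G.rot_fst
  rot_cyclic := G.rot_cyclic

theorem card_add_card_face :
    Fintype.card V + Nat.card G.toRotationSystem.Face =
      Nat.card G.toRotationSystem.graph.edgeSet + 2 := by
  have h := G.euler
  change (Fintype.card V : ℤ) - (Nat.card G.toRotationSystem.graph.edgeSet : ℤ) +
    (Nat.card G.toRotationSystem.Face : ℤ) = 2 at h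
  omega

/-- The pairs `{a, c}` and `{b, d}` alternate in the linear order. -/
def Alternate {k : ℕ} (a b c d : Fin k) : Prop :=
  (a < b ∧ b < c ∧ (d < a ∨ c < d)) ∨ (c < b ∧ b < a ∧ (d < c ∨ a < d)) ∨
  (a < d ∧ d < c ∧ (b < a ∨ c < b)) ∨ (c < d ∧ d < a ∧ (b < c ∨ a < b))

/-- Of the three ways to pair four points of a circle, one crosses. Excluding two pairings by
disjoint walks thus identifies the crossing one without computing the outer order of the grid. -/
theorem alternate_trichotomy {k : ℕ} {a b c d : Fin k} (hab : a ≠ b) (hac : a ≠ c) (had : a ≠ d)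
    (hbc : b ≠ c) (hbd : b ≠ d) (hcd : c ≠ d) :
    Alternate a b c d ∨ Alternate a c b d ∨ Alternate a b d c := by
  simp only [Alternate]
  rcases lt_or_gt_of_ne hab with h1 | h1 <;> rcases lt_or_gt_of_ne hac with h2 | h2 <;>
  rcases lt_or_gt_of_ne had with h3 | h3 <;> rcases lt_or_gt_of_ne hbc with h4 | h4 <;>
  rcases lt_or_gt_of_ne hbd with h5 | h5 <;> rcases lt_or_gt_of_ne hcd with h6 | h6 <;>
  simp only [h1, h2, h3, h4, h5, h6, h1.not_gt, h2.not_gt, h3.not_gt, h4.not_gt, h5.not_gt,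
    h6.not_gt, and_true, and_false, or_true, or_false]

variable {G} in
theorem IsOuterOrder.exists_mem_support {k : ℕ} {v : Fin k → V} (hv : G.IsOuterOrder v)
    {a b c d : Fin k} (h : Alternate a b c d) (P : G.graph.Walk (v a) (v c))
    (Q : G.graph.Walk (v b) (v d)) : ∃ x ∈ P.support, x ∈ Q.support := by
  obtain ⟨d₀, -, p, hp, hpv⟩ := hv
  have key : ∀ {a b c d : Fin k} (_ : a < b) (_ : b < c) (_ : c < d)
      (P : G.graph.Walk (v a) (v c)) (Q : G.graph.Walk (v b) (v d)),
      ∃ x ∈ P.support, x ∈ Q.support := by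
    intro a b c d hab hbc hcd P Q
    exact G.toRotationSystem.exists_mem_support_of_alternating G.card_add_card_face d₀
      (hp hab) (hp hbc) (hp hcd) (hpv d).1 (hpv a).2 (hpv b).2 (hpv c).2 (hpv d).2 P Q
  have key' : ∀ {a b c d : Fin k} (_ : a < b) (_ : b < c) (_ : d < a ∨ c < d)
      (P : G.graph.Walk (v a) (v c)) (Q : G.graph.Walk (v b) (v d)),
      ∃ x ∈ P.support, x ∈ Q.support := by
    rintro a b c d hab hbc (hda | hcd) P Q
    · obtain ⟨x, hx, hx'⟩ := key hda hab hbc Q.reverse P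
      exact ⟨x, hx', by simpa using hx⟩
    · exact key hab hbc hcd P Q
  rcases h with ⟨h1, h2, h3⟩ | ⟨h1, h2, h3⟩ | ⟨h1, h2, h3⟩ | ⟨h1, h2, h3⟩
  · exact key' h1 h2 h3 P Q
  · simpa using key' h1 h2 h3 P.reverse Q
  · simpa using key' h1 h2 h3 P Q.reverse
  · simpa using key' h1 h2 h3 P.reverse Q.reverse

end PlaneGraph

namespace PlanarInstance

variable {T V V' : Type*} [Fintype T] [Fintype V] [Fintype V']

/-- If the terminals `a, b, c, d` lie on the outer face of `G` in such an order that the other two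
pairings can be realized by disjoint walks, then walks from `a` to `c` and from `b` to `d` meet
in every graph with the same outer order. -/
theorem SameOuterOrder.exists_mem_support {H : PlanarInstance T V'} {G : PlanarInstance T V}
    (hHG : SameOuterOrder H G) {a b c d : T} (hab : a ≠ b) (hac : a ≠ c) (had : a ≠ d)
    (hbc : b ≠ c) (hbd : b ≠ d) (hcd : c ≠ d)
    (hG₁ : ∃ (P : G.graph.Walk (G.terminal a) (G.terminal b))
      (Q : G.graph.Walk (G.terminal c) (G.terminal d)), ∀ x ∈ P.support, x ∉ Q.support)
    (hG₂ : ∃ (P : G.graph.Walk (G.terminal a) (G.terminal d))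
      (Q : G.graph.Walk (G.terminal b) (G.terminal c)), ∀ x ∈ P.support, x ∉ Q.support)
    (P : H.graph.Walk (H.terminal a) (H.terminal c))
    (Q : H.graph.Walk (H.terminal b) (H.terminal d)) : ∃ x ∈ P.support, x ∈ Q.support := by
  obtain ⟨σ, hσG, hσH⟩ := hHG
  obtain ⟨a, rfl⟩ := σ.surjective a
  obtain ⟨b, rfl⟩ := σ.surjective b
  obtain ⟨c, rfl⟩ := σ.surjective c
  obtain ⟨d, rfl⟩ := σ.surjective d
  rcases PlaneGraph.alternate_trichotomy (ne_of_apply_ne σ hab) (ne_of_apply_ne σ hac)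
    (ne_of_apply_ne σ had) (ne_of_apply_ne σ hbc) (ne_of_apply_ne σ hbd)
    (ne_of_apply_ne σ hcd) with h | h | h
  · exact hσH.exists_mem_support h P Q
  · obtain ⟨P, Q, hPQ⟩ := hG₁
    obtain ⟨x, hx, hx'⟩ := hσG.exists_mem_support h P Q
    exact absurd hx' (hPQ x hx)
  · obtain ⟨P, Q, hPQ⟩ := hG₂
    obtain ⟨x, hx, hx'⟩ := hσG.exists_mem_support h P Q
    exact absurd hx' (hPQ x hx)

end PlanarInstance

/-! ### The grid as a plane graph -/

namespace Grid

open SimpleGraph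

/-- The lattice points of `[0, A) × [0, B)`. -/
noncomputable def points (A B : ℕ) : Finset (ℤ × ℤ) := Finset.Ico 0 (A : ℤ) ×ˢ Finset.Ico 0 (B : ℤ)

theorem mem_points {A B : ℕ} {p : ℤ × ℤ} :
    p ∈ points A B ↔ (0 ≤ p.1 ∧ p.1 < A) ∧ 0 ≤ p.2 ∧ p.2 < B := by
  simp [points]

theorem card_points (A B : ℕ) : (points A B).card = A * B := by
  simp [points]

/-- The unit vectors in the four directions, in counterclockwise order. -/
def step : Fin 4 → ℤ × ℤ := ![(1, 0), (0, 1), (-1, 0), (0, -1)]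

theorem step_injective : Function.Injective step := by decide

theorem step_ne_zero (i : Fin 4) : step i ≠ 0 := by revert i; decide

theorem step_add_two (i : Fin 4) : step (i + 2) = -step i := by revert i; decide

/-- The next direction after `i`, in counterclockwise order, that is available. -/
def nextDir (S : Fin 4 → Bool) (i : Fin 4) : Fin 4 :=
  if S (i + 1) then i + 1 else if S (i + 2) then i + 2 else if S (i + 3) then i + 3 else i

/-- The previous available direction. -/
def prevDir (S : Fin 4 → Bool) (i : Fin 4) : Fin 4 :=
  if S (i + 3) then i + 3 else if S (i + 2) then i + 2 else if S (i + 1) then i + 1 else i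

theorem nextDir_avail : ∀ (S : Fin 4 → Bool) (i : Fin 4), S i → S (nextDir S i) := by decide

theorem prevDir_avail : ∀ (S : Fin 4 → Bool) (i : Fin 4), S i → S (prevDir S i) := by decide

theorem prevDir_nextDir : ∀ (S : Fin 4 → Bool) (i : Fin 4), S i → prevDir S (nextDir S i) = i := by
  decide

theorem nextDir_prevDir : ∀ (S : Fin 4 → Bool) (i : Fin 4), S i → nextDir S (prevDir S i) = i := by
  decide

theorem exists_iterate_nextDir : ∀ (S : Fin 4 → Bool) (i j : Fin 4), S i → S j →
    ∃ t : Fin 4, (nextDir S)^[t.1] i = j := by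
  decide

variable (A B : ℕ)

/-- The grid graph. -/
def graph : SimpleGraph (points A B) where
  Adj v w := ∃ i, w.1 = v.1 + step i
  symm := ⟨by
    rintro v w ⟨i, hi⟩
    exact ⟨i + 2, by rw [hi, step_add_two]; abel⟩⟩
  loopless := ⟨by
    rintro v ⟨i, hi⟩
    exact step_ne_zero i (by simpa using hi)⟩

/-- The directions in which one can leave a point. -/
noncomputable def avail (p : ℤ × ℤ) (i : Fin 4) : Bool := decide (p + step i ∈ points A B)

variable {A B}

theorem avail_iff {p : ℤ × ℤ} {i : Fin 4} : avail A B p i ↔ p + step i ∈ points A B := by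
  simp [avail]

/-- The direction of a dart. -/
noncomputable def dir (d : (graph A B).Dart) : Fin 4 := d.adj.choose

theorem snd_eq (d : (graph A B).Dart) : d.snd.1 = d.fst.1 + step (dir d) := d.adj.choose_spec

theorem avail_dir (d : (graph A B).Dart) : avail A B d.fst.1 (dir d) := by
  rw [avail_iff, ← snd_eq]; exact d.snd.2

/-- The dart that leaves `v` in the direction `i`. -/
def mkDart (v : points A B) (i : Fin 4) (h : avail A B v.1 i) : (graph A B).Dart :=
  ⟨(v, ⟨v.1 + step i, avail_iff.1 h⟩), ⟨i, rfl⟩⟩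

theorem dir_mkDart (v : points A B) (i : Fin 4) (h : avail A B v.1 i) : dir (mkDart v i h) = i :=
  step_injective (add_left_cancel (snd_eq (mkDart v i h)).symm)

theorem dart_ext {d d' : (graph A B).Dart} (h : d.fst = d'.fst) (h' : dir d = dir d') :
    d = d' := by
  refine Dart.ext _ _ (Prod.ext h (Subtype.ext ?_))
  rw [snd_eq, snd_eq, h, h']

theorem dir_symm (d : (graph A B).Dart) : dir d.symm = dir d + 2 := by
  apply step_injective
  have h := snd_eq d.symm
  change d.fst.1 = d.snd.1 + _ at h
  rw [snd_eq] at h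
  rw [step_add_two]
  have h2 : step (dir d) + step (dir d.symm) = 0 := by
    rw [add_assoc] at h
    exact left_eq_add.1 h
  exact (neg_eq_of_add_eq_zero_right h2).symm

/-- Each dart is followed, in the counterclockwise order, by the next one with the same tail. -/
noncomputable def rot : Equiv.Perm (graph A B).Dart where
  toFun d := mkDart d.fst (nextDir (avail A B d.fst.1) (dir d)) (nextDir_avail _ _ (avail_dir d))
  invFun d := mkDart d.fst (prevDir (avail A B d.fst.1) (dir d)) (prevDir_avail _ _ (avail_dir d))
  left_inv d := by
    refine dart_ext rfl ?_
    rw [dir_mkDart, dir_mkDart]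
    exact prevDir_nextDir _ _ (avail_dir d)
  right_inv d := by
    refine dart_ext rfl ?_
    rw [dir_mkDart, dir_mkDart]
    exact nextDir_prevDir _ _ (avail_dir d)

theorem rot_fst (d : (graph A B).Dart) : (rot d).fst = d.fst := rfl

theorem dir_rot (d : (graph A B).Dart) : dir (rot d) = nextDir (avail A B d.fst.1) (dir d) :=
  dir_mkDart _ _ (nextDir_avail _ _ (avail_dir d))

theorem rot_cyclic (d d' : (graph A B).Dart) (h : d.fst = d'.fst) :
    (rot (A := A) (B := B)).SameCycle d d' := by
  obtain ⟨t, ht⟩ := exists_iterate_nextDir _ _ _ (avail_dir d) (h ▸ avail_dir d')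
  refine ⟨t.1, ?_⟩
  have : ∀ s : ℕ, ((rot ^ s) d).fst = d.fst ∧
      dir ((rot ^ s) d) = (nextDir (avail A B d.fst.1))^[s] (dir d) := by
    intro s
    induction s with
    | zero => simp
    | succ s ih =>
      rw [pow_succ', Equiv.Perm.mul_apply, rot_fst, dir_rot, ih.1, ih.2,
        Function.iterate_succ_apply']
      exact ⟨rfl, rfl⟩
  rw [zpow_natCast]
  exact dart_ext ((this t).1.trans h) ((this t).2.trans ht)

/-- Two vertices are joined by a walk inside the box that they span. -/
theorem exists_walk_in_box (u v : points A B) : ∃ p : (graph A B).Walk u v, ∀ w ∈ p.support,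
    (min u.1.1 v.1.1 ≤ w.1.1 ∧ w.1.1 ≤ max u.1.1 v.1.1) ∧
      min u.1.2 v.1.2 ≤ w.1.2 ∧ w.1.2 ≤ max u.1.2 v.1.2 := by
  generalize hn : (u.1.1 - v.1.1).natAbs + (u.1.2 - v.1.2).natAbs = n
  induction n generalizing u with
  | zero =>
    obtain rfl : u = v := Subtype.ext (Prod.ext (by omega) (by omega))
    exact ⟨Walk.nil, by simp⟩
  | succ n ih =>
    have hu := mem_points.1 u.2
    have hv := mem_points.1 v.2
    obtain ⟨i, hi⟩ : ∃ i, ((u.1 + step i).1 - v.1.1).natAbs +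
        ((u.1 + step i).2 - v.1.2).natAbs = n ∧
        (min u.1.1 v.1.1 ≤ (u.1 + step i).1 ∧ (u.1 + step i).1 ≤ max u.1.1 v.1.1) ∧
        min u.1.2 v.1.2 ≤ (u.1 + step i).2 ∧ (u.1 + step i).2 ≤ max u.1.2 v.1.2 := by
      rcases lt_trichotomy u.1.1 v.1.1 with h | h | h
      · exact ⟨0, by simp [step]; omega⟩
      · rcases lt_or_ge u.1.2 v.1.2 with h' | h'
        · exact ⟨1, by simp [step]; omega⟩
        · exact ⟨3, by simp [step]; omega⟩
      · exact ⟨2, by simp [step]; omega⟩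
    obtain ⟨h1, h2⟩ := hi
    have hmem : u.1 + step i ∈ points A B := mem_points.2 (by omega)
    obtain ⟨p, hp⟩ := ih ⟨u.1 + step i, hmem⟩ h1
    have hadj : (graph A B).Adj u ⟨u.1 + step i, hmem⟩ := ⟨i, rfl⟩
    refine ⟨Walk.cons hadj p, fun w hw => ?_⟩
    rw [Walk.support_cons, List.mem_cons] at hw
    rcases hw with rfl | hw
    · simp
    · have := hp w hw
      dsimp only at this
      omega

theorem connected (hA : 0 < A) (hB : 0 < B) : (graph A B).Connected := by
  have : Nonempty (points A B) := ⟨⟨(0, 0), mem_points.2 (by simp; omega)⟩⟩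
  exact ⟨fun u v => ⟨(exists_walk_in_box u v).choose⟩⟩

/-- The rotation system of the grid. -/
noncomputable abbrev rotationSystem (hA : 0 < A) (hB : 0 < B) : RotationSystem (points A B) where
  graph := graph A B
  connected := connected hA hB
  rot := rot
  rot_fst := rot_fst
  rot_cyclic := rot_cyclic

/-- The lower left corner of the cell to the right of the segment from `p` in the direction `i`. -/
def rightCell (p : ℤ × ℤ) (i : Fin 4) : ℤ × ℤ := p + ![(0, -1), (0, 0), (-1, 0), (-1, -1)] i

/-- The successor in a face turns as far to the right as possible. A cell on the right makes the
right turn available and is kept; with no cell on the right, the dart runs along the border, the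
right turn is blocked, and the walk stays on the border. -/
theorem rightCell_next {a b : ℕ} (ha : 0 < a) (p : ℤ × ℤ) (i : Fin 4)
    (hp : p ∈ points (a + 1) (b + 1)) (hi : p + step i ∈ points (a + 1) (b + 1)) :
    let j := nextDir (avail (a + 1) (b + 1) (p + step i)) (i + 2)
    (rightCell p i ∈ points a b → rightCell (p + step i) j = rightCell p i) ∧
      (rightCell p i ∉ points a b → rightCell (p + step i) j ∉ points a b) := by
  obtain ⟨x, y⟩ := p
  rw [mem_points] at hp hi
  fin_cases i <;> simp [nextDir, avail_iff, mem_points, step, rightCell] at hp hi ⊢ <;>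
    split_ifs <;> simp <;> omega

section faces

variable {a b : ℕ} (ha : 0 < a) (hb : 0 < b)

/-- The cell to the right of a dart, or `none` if that is the outer face. -/
noncomputable def cell (d : (graph (a + 1) (b + 1)).Dart) : Option (points a b) :=
  if h : rightCell d.fst.1 (dir d) ∈ points a b then some ⟨_, h⟩ else none

theorem cell_eq_none {d : (graph (a + 1) (b + 1)).Dart} :
    cell d = none ↔ rightCell d.fst.1 (dir d) ∉ points a b := by
  rw [cell]; split_ifs with h <;> simp [h]

include ha in
theorem cell_rot_symm (d : (graph (a + 1) (b + 1)).Dart) : cell (rot d.symm) = cell d := by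
  have h := rightCell_next (b := b) ha d.fst.1 (dir d) d.fst.2 (snd_eq d ▸ d.snd.2)
  have h1 : (rot d.symm).fst.1 = d.fst.1 + step (dir d) := snd_eq d
  have h2 : dir (rot d.symm) =
      nextDir (avail (a + 1) (b + 1) (d.fst.1 + step (dir d))) (dir d + 2) := by
    rw [dir_rot, dir_symm, ← snd_eq]
    rfl
  dsimp only at h
  rw [← h2, ← h1] at h
  unfold cell
  by_cases hc : rightCell d.fst.1 (dir d) ∈ points a b
  · have := h.1 hc
    simp only [this]
  · rw [dif_neg hc, dif_neg (h.2 hc)]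

/-- The cell of a face of the grid. -/
noncomputable def faceCell :
    (rotationSystem (A := a + 1) (B := b + 1) a.succ_pos b.succ_pos).Face → Option (points a b) :=
  Quotient.lift cell <| by
    rintro d d' ⟨n, rfl⟩
    have hz : ∀ (n : ℤ) (d : (graph (a + 1) (b + 1)).Dart),
        cell (((rotationSystem a.succ_pos b.succ_pos).faceNext ^ n) d) = cell d := by
      intro n
      induction n using Int.induction_on with
      | zero => simp
      | succ i ih =>
        intro d
        rw [zpow_add_one, Equiv.Perm.mul_apply, ih]
        exact cell_rot_symm ha d
      | pred i ih =>
        intro d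
        obtain ⟨e, rfl⟩ := (rotationSystem a.succ_pos b.succ_pos).faceNext.surjective d
        rw [← Equiv.Perm.mul_apply, ← zpow_add_one, sub_add_cancel, ih]
        exact (cell_rot_symm ha e).symm
    exact (hz n d).symm

/-- The first dart of the lower side of the grid. -/
noncomputable def lowerDart : (graph (a + 1) (b + 1)).Dart :=
  mkDart ⟨(0, 0), mem_points.2 (by simp)⟩ 0
    (avail_iff.2 (mem_points.2 (by simpa [step] using ha)))

theorem cell_lowerDart : cell (lowerDart ha : (graph (a + 1) (b + 1)).Dart) = none := by
  rw [cell_eq_none, lowerDart, dir_mkDart, mem_points]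
  simp [mkDart, rightCell]

/-- A cell is reached from the upward dart at its lower left corner. Injectivity is not proved
directly: it follows from the count of faces. -/
theorem faceCell_surjective : Function.Surjective (faceCell (b := b) ha) := by
  rintro (_ | ⟨c, hc⟩)
  · exact ⟨Quotient.mk _ (lowerDart ha), cell_lowerDart ha⟩
  · have hc' := mem_points.1 hc
    have h0 : c ∈ points (a + 1) (b + 1) := mem_points.2 (by push_cast; omega)
    have h1 : avail (a + 1) (b + 1) c 1 :=
      avail_iff.2 (mem_points.2 (by simp [step]; omega))
    refine ⟨Quotient.mk _ (mkDart ⟨c, h0⟩ 1 h1), ?_⟩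
    change cell (mkDart ⟨c, h0⟩ 1 h1) = _
    have h2 : rightCell (mkDart ⟨c, h0⟩ 1 h1).fst.1 (dir (mkDart ⟨c, h0⟩ 1 h1)) = c := by
      rw [dir_mkDart]
      simp [mkDart, rightCell]
    rw [cell, dif_pos (by rw [h2]; exact hc)]
    simp only [h2]

/-- Every edge goes right or up from one of its ends. An upper bound suffices for Euler's formula.
-/
theorem card_edgeSet_le :
    Nat.card (graph (a + 1) (b + 1)).edgeSet ≤ a * (b + 1) + (a + 1) * b := by
  have hE : ∀ v : points a (b + 1), ∃ e : (graph (a + 1) (b + 1)).edgeSet,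
      ∃ u w : points (a + 1) (b + 1), e.1 = s(u, w) ∧ u.1 = v.1 ∧ w.1 = v.1 + step 0 := by
    intro v
    have hv := mem_points.1 v.2
    refine ⟨⟨s(⟨v.1, mem_points.2 (by push_cast at hv ⊢; omega)⟩,
      ⟨v.1 + step 0, mem_points.2 (by simp [step]; push_cast at hv; omega)⟩), ⟨0, rfl⟩⟩,
      _, _, rfl, rfl, rfl⟩
  have hN : ∀ v : points (a + 1) b, ∃ e : (graph (a + 1) (b + 1)).edgeSet,
      ∃ u w : points (a + 1) (b + 1), e.1 = s(u, w) ∧ u.1 = v.1 ∧ w.1 = v.1 + step 1 := by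
    intro v
    have hv := mem_points.1 v.2
    refine ⟨⟨s(⟨v.1, mem_points.2 (by push_cast at hv ⊢; omega)⟩,
      ⟨v.1 + step 1, mem_points.2 (by simp [step]; push_cast at hv; omega)⟩), ⟨1, rfl⟩⟩,
      _, _, rfl, rfl, rfl⟩
  choose fE hfE using hE
  choose fN hfN using hN
  have key : ∀ u w : points (a + 1) (b + 1), ∀ h : s(u, w) ∈ (graph (a + 1) (b + 1)).edgeSet,
      (w.1 = u.1 + step 0 ∨ w.1 = u.1 + step 1) →
      ∃ x, Sum.elim fE fN x = ⟨s(u, w), h⟩ := by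
    rintro u w h (h' | h')
    · have hu := mem_points.1 u.2
      have hw := mem_points.1 w.2
      rw [h'] at hw
      simp [step] at hw
      obtain ⟨u', w', h1, h2, h3⟩ := hfE ⟨u.1, mem_points.2 (by push_cast at hu ⊢; omega)⟩
      refine ⟨Sum.inl _, Subtype.ext (h1.trans ?_)⟩
      rw [Subtype.ext h2, Subtype.ext (h3.trans h'.symm)]
    · have hu := mem_points.1 u.2
      have hw := mem_points.1 w.2
      rw [h'] at hw
      simp [step] at hw
      obtain ⟨u', w', h1, h2, h3⟩ := hfN ⟨u.1, mem_points.2 (by push_cast at hu ⊢; omega)⟩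
      refine ⟨Sum.inr _, Subtype.ext (h1.trans ?_)⟩
      rw [Subtype.ext h2, Subtype.ext (h3.trans h'.symm)]
  have hsurj : Function.Surjective (Sum.elim fE fN) := by
    rintro ⟨⟨u, w⟩, h⟩
    obtain ⟨i, hi⟩ := id h
    have hi' : u.1 = w.1 + step (i + 2) := by rw [hi, step_add_two]; abel
    have hsw : (⟨s(u, w), h⟩ : (graph (a + 1) (b + 1)).edgeSet) =
        ⟨s(w, u), (graph (a + 1) (b + 1)).symm.symm _ _ h⟩ := Subtype.ext Sym2.eq_swap
    fin_cases i
    · exact key u w h (Or.inl hi)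
    · exact key u w h (Or.inr hi)
    · exact hsw ▸ key w u _ (Or.inl hi')
    · exact hsw ▸ key w u _ (Or.inr hi')
  refine (Nat.card_le_card_of_surjective _ hsurj).trans ?_
  simp [card_points]

theorem card_option_cell : Nat.card (Option (points a b)) = a * b + 1 := by
  simp [card_points]

-- At least `a * b + 1` faces, the upper bound for the edges, and the inequality for arbitrary genus
-- squeeze all three to equalities.
include ha in
theorem card_add_card_face :
    Fintype.card (points (a + 1) (b + 1)) +
        Nat.card (rotationSystem (A := a + 1) (B := b + 1) a.succ_pos b.succ_pos).Face =
      Nat.card (graph (a + 1) (b + 1)).edgeSet + 2 ∧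
    Nat.card (rotationSystem (A := a + 1) (B := b + 1) a.succ_pos b.succ_pos).Face = a * b + 1 := by
  have h1 := (rotationSystem (A := a + 1) (B := b + 1) a.succ_pos b.succ_pos).card_add_card_face_le
  have := (rotationSystem (A := a + 1) (B := b + 1) a.succ_pos b.succ_pos).finite_face
  have h2 := Nat.card_le_card_of_surjective _ (faceCell_surjective (b := b) ha)
  have h3 := card_edgeSet_le (a := a) (b := b)
  rw [card_option_cell] at h2
  rw [Fintype.card_coe, card_points] at h1 ⊢
  have h4 : (a + 1) * (b + 1) + (a * b + 1) = a * (b + 1) + (a + 1) * b + 2 := by ring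
  dsimp only at h1
  omega

/-- The grid with `a` columns and `b` rows of cells as a plane graph. -/
noncomputable def planeGraph : PlaneGraph (points (a + 1) (b + 1)) where
  graph := graph (a + 1) (b + 1)
  connected := connected a.succ_pos b.succ_pos
  rot := rot
  rot_fst := rot_fst
  rot_cyclic := rot_cyclic
  euler := by
    have h := (card_add_card_face (b := b) ha).1
    change (Fintype.card (points (a + 1) (b + 1)) : ℤ) -
      (Nat.card (graph (a + 1) (b + 1)).edgeSet : ℤ) +
      (Nat.card (rotationSystem (A := a + 1) (B := b + 1) a.succ_pos b.succ_pos).Face : ℤ) = 2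
    omega
  outer := lowerDart ha

/-- By the count of faces, `faceCell` is a bijection, so all darts without a cell on their right
form a single face. This avoids tracing the boundary walk. -/
theorem sameCycle_outer (d : (graph (a + 1) (b + 1)).Dart) (hd : cell d = none) :
    (planeGraph (b := b) ha).faceNext.SameCycle (planeGraph ha).outer d := by
  have := (rotationSystem (A := a + 1) (B := b + 1) a.succ_pos b.succ_pos).finite_face
  have hinj : Function.Injective (faceCell (b := b) ha) :=
    ((faceCell_surjective ha).bijective_of_nat_card_le (by
      rw [card_option_cell, (card_add_card_face ha).2])).1
  have h : (rotationSystem a.succ_pos b.succ_pos).face (lowerDart ha) =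
      (rotationSystem a.succ_pos b.succ_pos).face d :=
    hinj ((cell_lowerDart ha).trans hd.symm)
  exact (RotationSystem.face_eq_iff _).1 h

include hb in
/-- The vertices of the lower and of the upper side lie on the outer face. -/
theorem onOuterFace (v : points (a + 1) (b + 1)) (hv : v.1.2 = 0 ∨ v.1.2 = b) :
    (planeGraph (b := b) ha).OnOuterFace v := by
  obtain ⟨i, h, hi⟩ : ∃ i, avail (a + 1) (b + 1) v.1 i ∧ rightCell v.1 i ∉ points a b := by
    have hm := mem_points.1 v.2
    simp only [avail_iff, mem_points]
    push_cast at hm ⊢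
    rcases hv with hv | hv
    · by_cases hx : v.1.1 < a
      · exact ⟨0, by simp [step]; omega, by simp [rightCell]; omega⟩
      · exact ⟨1, by simp [step]; omega, by simp [rightCell]; omega⟩
    · by_cases hx : 0 < v.1.1
      · exact ⟨2, by simp [step]; omega, by simp [rightCell]; omega⟩
      · exact ⟨3, by simp [step]; omega, by simp [rightCell]; omega⟩
  refine ⟨mkDart v i h, sameCycle_outer ha _ (cell_eq_none.2 ?_), rfl⟩
  rw [dir_mkDart]
  exact hi

end faces

end Grid

/-! ### Lengths of walks and distances -/

namespace PlanarInstance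

open SimpleGraph

variable {T V : Type*} [Fintype V] (G : PlanarInstance T V)

/-- The length of a walk. -/
def length {u v : V} (p : G.graph.Walk u v) : ℝ := (p.edges.map G.weight).sum

theorem length_nonneg {u v : V} (p : G.graph.Walk u v) : 0 ≤ G.length p := by
  refine List.sum_nonneg fun x hx => ?_
  obtain ⟨e, he, rfl⟩ := List.mem_map.1 hx
  exact G.weight_nonneg e (p.edges_subset_edgeSet he)

theorem length_nil {u : V} : G.length (Walk.nil : G.graph.Walk u u) = 0 := by simp [length]

theorem length_cons {u v w : V} (h : G.graph.Adj u v) (p : G.graph.Walk v w) :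
    G.length (Walk.cons h p) = G.weight s(u, v) + G.length p := by
  simp [length]

theorem length_append {u v w : V} (p : G.graph.Walk u v) (p' : G.graph.Walk v w) :
    G.length (p.append p') = G.length p + G.length p' := by
  simp [length, Walk.edges_append]

theorem dist_le_length {u v : V} (p : G.graph.Walk u v) : G.dist u v ≤ G.length p :=
  ciInf_le ⟨0, by rintro _ ⟨p, rfl⟩; exact G.length_nonneg p⟩ p

theorem exists_length_lt {u v : V} {r : ℝ} (h : G.dist u v < r) :
    ∃ p : G.graph.Walk u v, G.length p < r := by
  have : Nonempty (G.graph.Walk u v) := G.connected.preconnected u v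
  exact exists_lt_of_ciInf_lt h

/-- Increments telescope along a walk. All lower bounds for distances in the grid come from such a
function. -/
theorem sub_le_dist (f : V → ℝ) (hf : ∀ u v, G.graph.Adj u v → f v - f u ≤ G.weight s(u, v))
    (u v : V) : f v - f u ≤ G.dist u v := by
  have : Nonempty (G.graph.Walk u v) := G.connected.preconnected u v
  refine le_ciInf fun p => ?_
  change f v - f u ≤ G.length p
  induction p with
  | nil => simp [length]
  | cons h p ih =>
    rw [length_cons]
    linarith [hf _ _ h, ih (G.connected.preconnected _ _)]

/-- Two walks that meet can exchange their ends. -/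
theorem dist_add_dist_le {u v u' v' x : V} (p : G.graph.Walk u v) (p' : G.graph.Walk u' v')
    (hx : x ∈ p.support) (hx' : x ∈ p'.support) :
    G.dist u v' + G.dist u' v ≤ G.length p + G.length p' := by
  classical
  have h1 := G.dist_le_length ((p.takeUntil x hx).append (p'.dropUntil x hx'))
  have h2 := G.dist_le_length ((p'.takeUntil x hx').append (p.dropUntil x hx))
  have h3 := congr_arg G.length (p.take_spec hx)
  have h4 := congr_arg G.length (p'.take_spec hx')
  rw [length_append] at h1 h2 h3 h4
  linarith

end PlanarInstance

/-! ### The weighted grid and its distances -/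

namespace Grid

open SimpleGraph PlanarInstance

/-- A potential; the edge weights are its differences. It increases along the lattice paths that
alternate between vertical steps up from points with even coordinate sum and horizontal steps. -/
def potential (p : ℤ × ℤ) : ℤ := 2 * p.2 - (p.1 + p.2) % 2

/-- The position of the terminal `t`: the terminals `0, …, m - 1` are on the lower side and
`m, …, 2 m - 1` are on the upper side, at even abscissas, and `2 m` is the lower right corner. -/
def terminalPos (m q t : ℕ) : ℤ × ℤ :=
  if t < m then (2 * t, 0) else if t < 2 * m then (2 * (t - m), 2 * q) else (2 * m, 0)

theorem terminalPos_mem (m q t : ℕ) : terminalPos m q t ∈ points (2 * m + 1) (2 * q + 1) := by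
  rw [mem_points, terminalPos]
  split_ifs <;> refine ⟨⟨?_, ?_⟩, ?_, ?_⟩ <;> dsimp only <;> omega

theorem terminalPos_injective {m q k : ℕ} (hq : 0 < q) (hk : k ≤ 2 * m + 1) {s t : ℕ} (hs : s < k)
    (ht : t < k) (h : terminalPos m q s = terminalPos m q t) : s = t := by
  rw [terminalPos, terminalPos] at h
  split_ifs at h <;> rw [Prod.mk.injEq] at h <;> omega

/-- The potential has the parity of the coordinate sum, which changes along every edge. -/
theorem one_le_abs_potential_sub {A B : ℕ} {u v : points A B} (h : (graph A B).Adj u v) :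
    1 ≤ |potential u.1 - potential v.1| := by
  obtain ⟨i, hi⟩ := h
  refine Int.one_le_abs fun h => ?_
  rw [hi] at h
  fin_cases i <;> simp [potential, step] at h <;> omega

/-- The weighted grid of `2 m` by `2 q` cells with terminals on the lower and the upper side. -/
noncomputable def gridInstance {m q k : ℕ} (hm : 0 < m) (hq : 0 < q) (hk : k ≤ 2 * m + 1) :
    PlanarInstance (Fin k) (points (2 * m + 1) (2 * q + 1)) where
  toPlaneGraph := planeGraph (Nat.mul_pos two_pos hm)
  -- Vertical edges with lower end of odd coordinate sum have weight `3`, all others weight `1`.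
  weight := Sym2.lift ⟨fun u v => ((|potential u.1 - potential v.1| : ℤ) : ℝ), fun u v => by
    dsimp only; rw [abs_sub_comm]⟩
  weight_nonneg := by
    rintro ⟨u, v⟩ -
    exact Int.cast_nonneg (abs_nonneg _)
  terminal := ⟨fun t => ⟨terminalPos m q t, terminalPos_mem m q t⟩, fun s t h =>
    Fin.ext (terminalPos_injective hq hk s.2 t.2 (Subtype.ext_iff.1 h))⟩

section

variable {m q k : ℕ} (hm : 0 < m) (hq : 0 < q) (hk : k ≤ 2 * m + 1)

theorem weight_mk (u v : points (2 * m + 1) (2 * q + 1)) :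
    (gridInstance hm hq hk).weight s(u, v) = ((|potential u.1 - potential v.1| : ℤ) : ℝ) := rfl

theorem isOneHole : (gridInstance hm hq hk).IsOneHole := by
  intro t
  refine onOuterFace (Nat.mul_pos two_pos hm) (Nat.mul_pos two_pos hq) _ ?_
  change (terminalPos m q t).2 = 0 ∨ (terminalPos m q t).2 = _
  rw [terminalPos]
  split_ifs <;> simp

theorem weight_pos (e) (he : e ∈ (gridInstance hm hq hk).graph.edgeSet) :
    0 < (gridInstance hm hq hk).weight e := by
  obtain ⟨u, v⟩ := e
  have := one_le_abs_potential_sub (u := u) (v := v) he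
  exact Int.cast_pos.2 (zero_lt_one.trans_le this)

theorem potential_sub_le_dist (u v : points (2 * m + 1) (2 * q + 1)) :
    ((potential v.1 - potential u.1 : ℤ) : ℝ) ≤ (gridInstance hm hq hk).dist u v := by
  rw [Int.cast_sub]
  refine (gridInstance hm hq hk).sub_le_dist (fun v => (potential v.1 : ℝ)) (fun u v _ => ?_) u v
  rw [weight_mk, abs_sub_comm, ← Int.cast_sub]
  exact Int.cast_le.2 (le_abs_self _)

theorem sub_le_dist_of_step_le_one (f : ℤ × ℤ → ℤ) (hf : ∀ p i, f (p + step i) - f p ≤ 1)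
    (u v : points (2 * m + 1) (2 * q + 1)) :
    ((f v.1 - f u.1 : ℤ) : ℝ) ≤ (gridInstance hm hq hk).dist u v := by
  rw [Int.cast_sub]
  refine (gridInstance hm hq hk).sub_le_dist (fun v => (f v.1 : ℝ)) (fun u v h => ?_) u v
  rw [weight_mk, ← Int.cast_sub]
  refine Int.cast_le.2 (le_trans ?_ (one_le_abs_potential_sub h))
  obtain ⟨i, hi⟩ := h
  rw [hi]
  exact hf _ _

/-- The staircase walks. -/
theorem exists_staircase (σ : ℤ) (hσ : σ = 1 ∨ σ = -1) (n : ℕ)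
    (u v : points (2 * m + 1) (2 * q + 1)) (hu : (u.1.1 + u.1.2) % 2 = 0)
    (h1 : v.1.1 = u.1.1 + σ * n) (h2 : v.1.2 = u.1.2 + n) :
    ∃ p : (gridInstance hm hq hk).graph.Walk u v, (gridInstance hm hq hk).length p = 2 * n := by
  induction n generalizing u with
  | zero =>
    obtain rfl : v = u := Subtype.ext (Prod.ext (by simpa using h1) (by simpa using h2))
    exact ⟨Walk.nil, by simp [length_nil]⟩
  | succ n ih =>
    have hu' := mem_points.1 u.2
    have hv' := mem_points.1 v.2
    push_cast at hu' hv' h1 h2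
    have hσn : v.1.1 = u.1.1 + σ + σ * n := by rw [h1]; ring
    have hσn' : σ * n = n ∧ σ = 1 ∨ σ * n = -n ∧ σ = -1 := by
      rcases hσ with rfl | rfl <;> simp
    let u₁ : points (2 * m + 1) (2 * q + 1) :=
      ⟨(u.1.1, u.1.2 + 1), mem_points.2 (by push_cast; omega)⟩
    let u₂ : points (2 * m + 1) (2 * q + 1) :=
      ⟨(u.1.1 + σ, u.1.2 + 1), mem_points.2 (by push_cast; omega)⟩
    have hadj₁ : (gridInstance hm hq hk).graph.Adj u u₁ :=
      ⟨1, Prod.ext (by simp [u₁, step]) (by simp [u₁, step])⟩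
    have hadj₂ : (gridInstance hm hq hk).graph.Adj u₁ u₂ := by
      rcases hσ with rfl | rfl
      · exact ⟨0, Prod.ext (by simp [u₁, u₂, step]) (by simp [u₁, u₂, step])⟩
      · exact ⟨2, Prod.ext (by simp [u₁, u₂, step]) (by simp [u₁, u₂, step])⟩
    obtain ⟨p, hp⟩ := ih u₂ (by simp only [u₂]; omega) (by simp only [u₂]; omega)
      (by simp only [u₂]; omega)
    refine ⟨Walk.cons hadj₁ (Walk.cons hadj₂ p), ?_⟩
    have w₁ : |potential u.1 - potential u₁.1| = 1 := by
      have : potential u.1 - potential u₁.1 = -1 := by simp only [potential, u₁]; omega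
      rw [this]; rfl
    have w₂ : |potential u₁.1 - potential u₂.1| = 1 := by
      have : potential u₁.1 - potential u₂.1 = -1 := by simp only [potential, u₁, u₂]; omega
      rw [this]; rfl
    rw [length_cons, length_cons, hp, weight_mk, weight_mk, w₁, w₂]
    push_cast
    ring

variable (hk' : 2 * m ≤ k)

include hk' in
theorem dist_le_of_shift (σ : ℤ) (hσ : σ = 1 ∨ σ = -1) {i j : ℕ} (hi : i < m) (hj : j < m)
    (hij : (j : ℤ) = i + σ * q) :
    (gridInstance hm hq hk).dist ((gridInstance hm hq hk).terminal ⟨i, by omega⟩)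
      ((gridInstance hm hq hk).terminal ⟨m + j, by omega⟩) ≤ 4 * q := by
  obtain ⟨p, hp⟩ := exists_staircase hm hq hk σ hσ (2 * q)
    ((gridInstance hm hq hk).terminal ⟨i, by omega⟩)
    ((gridInstance hm hq hk).terminal ⟨m + j, by omega⟩)
    (by change ((terminalPos m q i).1 + (terminalPos m q i).2) % 2 = 0
        simp [terminalPos, hi])
    (by change (terminalPos m q (m + j)).1 = (terminalPos m q i).1 + _
        simp [terminalPos, hi, show m + j < 2 * m by omega, hij]; ring)
    (by change (terminalPos m q (m + j)).2 = (terminalPos m q i).2 + _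
        simp [terminalPos, hi, show m + j < 2 * m by omega])
  refine (dist_le_length _ p).trans (le_of_eq ?_)
  rw [hp]; push_cast; ring

include hk' in
theorem le_dist_terminal {i j : ℕ} (hi : i < m) (hj : j < m) :
    ((max (4 * q) (2 * q + 2 * |(j : ℤ) - i|) : ℤ) : ℝ) ≤
    (gridInstance hm hq hk).dist ((gridInstance hm hq hk).terminal ⟨i, by omega⟩)
      ((gridInstance hm hq hk).terminal ⟨m + j, by omega⟩) := by
  set u := (gridInstance hm hq hk).terminal ⟨i, by omega⟩ with hu
  set v := (gridInstance hm hq hk).terminal ⟨m + j, by omega⟩ with hv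
  have eu : u.1 = (2 * (i : ℤ), 0) := by
    change terminalPos m q i = _
    simp [terminalPos, hi]
  have ev : v.1 = (2 * (j : ℤ), 2 * (q : ℤ)) := by
    change terminalPos m q (m + j) = _
    simp [terminalPos, show m + j < 2 * m by omega]
  -- The potential yields `4 * q`; the two diagonal coordinates yield `2 * q ± 2 * (j - i)`.
  have h1 := potential_sub_le_dist hm hq hk u v
  have h2 := sub_le_dist_of_step_le_one hm hq hk (fun p => p.2 + p.1)
    (by intro p i; fin_cases i <;> simp [step]) u v
  have h3 := sub_le_dist_of_step_le_one hm hq hk (fun p => p.2 - p.1)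
    (by intro p i; fin_cases i <;> simp [step]) u v
  have hc : (max (4 * q) (2 * q + 2 * |(j : ℤ) - i|) : ℤ) = potential v.1 - potential u.1 ∨
      (max (4 * q) (2 * q + 2 * |(j : ℤ) - i|) : ℤ) = (v.1.2 + v.1.1) - (u.1.2 + u.1.1) ∨
      (max (4 * q) (2 * q + 2 * |(j : ℤ) - i|) : ℤ) = (v.1.2 - v.1.1) - (u.1.2 - u.1.1) := by
    rw [eu, ev]
    simp only [potential]
    rcases abs_cases ((j : ℤ) - i) with ⟨h, -⟩ | ⟨h, -⟩ <;> rw [h] <;> omega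
  rcases hc with h | h | h <;> rw [h] <;> assumption

include hk' in
theorem le_dist_add_dist (σ : ℤ) (hσ : σ = 1 ∨ σ = -1) {i j i' j' : ℕ} (hi : i < m) (hj : j < m)
    (hi' : i' < m) (hj' : j' < m) (hij : (j : ℤ) = i + σ * q) (hij' : (j' : ℤ) = i' + σ * q)
    (hne : i ≠ i') :
    (8 * q + 2 : ℝ) ≤
      (gridInstance hm hq hk).dist ((gridInstance hm hq hk).terminal ⟨i, by omega⟩)
        ((gridInstance hm hq hk).terminal ⟨m + j', by omega⟩) +
      (gridInstance hm hq hk).dist ((gridInstance hm hq hk).terminal ⟨i', by omega⟩)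
        ((gridInstance hm hq hk).terminal ⟨m + j, by omega⟩) := by
  refine le_trans ?_ (add_le_add (le_dist_terminal hm hq hk hk' hi hj')
    (le_dist_terminal hm hq hk hk' hi' hj))
  -- The exchanged shifts are `σ * q ± (i' - i)`. One of them has absolute value at least `q + 1`,
  -- which gives `4 * q + 2`; the other distance is at least `4 * q`.
  have h : (8 * q + 2 : ℤ) ≤ max (4 * (q : ℤ)) (2 * q + 2 * |(j' : ℤ) - i|) +
      max (4 * (q : ℤ)) (2 * q + 2 * |(j : ℤ) - i'|) := by
    have h1 := le_abs_self ((j' : ℤ) - i)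
    have h2 := neg_le_abs ((j' : ℤ) - i)
    have h3 := le_abs_self ((j : ℤ) - i')
    have h4 := neg_le_abs ((j : ℤ) - i')
    rcases hσ with rfl | rfl <;> omega
  exact_mod_cast h

include hk' in
/-- The other two pairings of the ends of two crossing staircases are realized by disjoint walks. -/
theorem exists_disjoint_walks {i j i' j' : ℕ} (hi : i < m) (hj : j < m) (hi' : i' < m)
    (hj' : j' < m) (h1 : i < i') (h2 : i < j) (h3 : j' < i') (h4 : j' < j) :
    (∃ (P : (gridInstance hm hq hk).graph.Walk ((gridInstance hm hq hk).terminal ⟨i, by omega⟩)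
        ((gridInstance hm hq hk).terminal ⟨i', by omega⟩))
      (Q : (gridInstance hm hq hk).graph.Walk
        ((gridInstance hm hq hk).terminal ⟨m + j, by omega⟩)
        ((gridInstance hm hq hk).terminal ⟨m + j', by omega⟩)),
      ∀ x ∈ P.support, x ∉ Q.support) ∧
    ∃ (P : (gridInstance hm hq hk).graph.Walk ((gridInstance hm hq hk).terminal ⟨i, by omega⟩)
        ((gridInstance hm hq hk).terminal ⟨m + j', by omega⟩))
      (Q : (gridInstance hm hq hk).graph.Walk
        ((gridInstance hm hq hk).terminal ⟨i', by omega⟩)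
        ((gridInstance hm hq hk).terminal ⟨m + j, by omega⟩)),
      ∀ x ∈ P.support, x ∉ Q.support := by
  have lower : ∀ (t : ℕ) (ht : t < m),
      ((gridInstance hm hq hk).terminal ⟨t, by omega⟩).1 = (2 * (t : ℤ), 0) := by
    intro t ht
    change terminalPos m q t = _
    simp [terminalPos, ht]
  have upper : ∀ (t : ℕ) (ht : t < m),
      ((gridInstance hm hq hk).terminal ⟨m + t, by omega⟩).1 = (2 * (t : ℤ), 2 * (q : ℤ)) := by
    intro t ht
    change terminalPos m q (m + t) = _
    simp [terminalPos, show m + t < 2 * m by omega]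
  constructor
  · obtain ⟨P, hP⟩ := exists_walk_in_box ((gridInstance hm hq hk).terminal ⟨i, by omega⟩)
      ((gridInstance hm hq hk).terminal ⟨i', by omega⟩)
    obtain ⟨Q, hQ⟩ := exists_walk_in_box ((gridInstance hm hq hk).terminal ⟨m + j, by omega⟩)
      ((gridInstance hm hq hk).terminal ⟨m + j', by omega⟩)
    -- The boxes are the segments at heights `0` and `2 * q`.
    refine ⟨P, Q, fun x hx hx' => ?_⟩
    have hxP := hP x hx
    have hxQ := hQ x hx'
    rw [lower _ hi, lower _ hi'] at hxP
    rw [upper _ hj, upper _ hj'] at hxQ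
    dsimp only at hxP hxQ
    omega
  · obtain ⟨P, hP⟩ := exists_walk_in_box ((gridInstance hm hq hk).terminal ⟨i, by omega⟩)
      ((gridInstance hm hq hk).terminal ⟨m + j', by omega⟩)
    obtain ⟨Q, hQ⟩ := exists_walk_in_box ((gridInstance hm hq hk).terminal ⟨i', by omega⟩)
      ((gridInstance hm hq hk).terminal ⟨m + j, by omega⟩)
    -- The boxes are separated by a vertical line, since `max i j' < min i' j`.
    refine ⟨P, Q, fun x hx hx' => ?_⟩
    have hxP := hP x hx
    have hxQ := hQ x hx'
    rw [lower _ hi, upper _ hj'] at hxP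
    rw [lower _ hi', upper _ hj] at hxQ
    dsimp only at hxP hxQ
    omega

/-! ### Counting crossings in an aligned emulator -/

include hk' in
/-- A lower bound for the size of the aligned emulators of the grid. -/
theorem le_card_of_isAlignedEmulator {ε : ℝ} (hε : Real.exp (2 * ε) * (4 * q) < 4 * q + 1)
    {V' : Type*} [Fintype V'] {H : PlanarInstance (Fin k) V'}
    (hH : IsAlignedEmulator ε H (gridInstance hm hq hk)) :
    (m - 2 * q) * q ≤ Fintype.card V' := by
  obtain ⟨hem, -, hord⟩ := hH
  -- This threshold exceeds the emulator distance between the ends of any staircase, and `2 * r` is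
  -- the least possible sum of two exchanged distances.
  set r : ℝ := Real.exp (-ε) * (4 * q + 1) with hr
  have hεr : Real.exp ε * (4 * q) < r := by
    have h : Real.exp ε = Real.exp (-ε) * Real.exp (2 * ε) := by
      rw [← Real.exp_add]; congr 1; ring
    rw [h, mul_assoc]
    exact mul_lt_mul_of_pos_left hε (Real.exp_pos _)
  have hwalk : ∀ (σ : ℤ) (_ : σ = 1 ∨ σ = -1) (i j : ℕ) (hi : i < m) (hj : j < m)
      (_ : (j : ℤ) = i + σ * q), ∃ p : H.graph.Walk (H.terminal ⟨i, by omega⟩)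
        (H.terminal ⟨m + j, by omega⟩), H.length p < r := by
    intro σ hσ i j hi hj hij
    refine H.exists_length_lt (lt_of_le_of_lt (hem _ _).2 (lt_of_le_of_lt ?_ hεr))
    exact mul_le_mul_of_nonneg_left (dist_le_of_shift hm hq hk hk' σ hσ hi hj hij)
      (Real.exp_pos _).le
  have hdisj : ∀ (σ : ℤ) (_ : σ = 1 ∨ σ = -1) (i j i' j' : ℕ) (hi : i < m) (hj : j < m)
      (hi' : i' < m) (hj' : j' < m) (_ : (j : ℤ) = i + σ * q) (_ : (j' : ℤ) = i' + σ * q)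
      (p : H.graph.Walk (H.terminal ⟨i, by omega⟩) (H.terminal ⟨m + j, by omega⟩))
      (p' : H.graph.Walk (H.terminal ⟨i', by omega⟩) (H.terminal ⟨m + j', by omega⟩))
      (_ : H.length p < r) (_ : H.length p' < r) (x : V') (_ : x ∈ p.support)
      (_ : x ∈ p'.support), i = i' := by
    intro σ hσ i j i' j' hi hj hi' hj' hij hij' p p' hp hp' x hx hx'
    by_contra hne
    have h1 := H.dist_add_dist_le p p' hx hx'
    have h2 := (hem ⟨i, by omega⟩ ⟨m + j', by omega⟩).1
    have h3 := (hem ⟨i', by omega⟩ ⟨m + j, by omega⟩).1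
    have h4 := mul_le_mul_of_nonneg_left
      (le_dist_add_dist hm hq hk hk' σ hσ hi hj hi' hj' hij hij' hne) (Real.exp_pos (-ε)).le
    rw [mul_add _ (PlanarInstance.dist _ _ _)] at h4
    have h5 : Real.exp (-ε) * (8 * q + 2) = 2 * r := by rw [hr]; ring
    linarith
  have hF : ∀ i : Fin (m - q), ∃ p : H.graph.Walk (H.terminal ⟨i, by omega⟩)
      (H.terminal ⟨m + (i + q), by omega⟩), H.length p < r := fun i =>
    hwalk 1 (Or.inl rfl) i (i + q) (by omega) (by omega) (by push_cast; ring)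
  have hB : ∀ j : Fin (m - q), ∃ p : H.graph.Walk (H.terminal ⟨j + q, by omega⟩)
      (H.terminal ⟨m + j, by omega⟩), H.length p < r := fun j =>
    hwalk (-1) (Or.inr rfl) (j + q) j (by omega) (by omega) (by push_cast; ring)
  choose F hF using hF
  choose B hB using hB
  -- The walk `F i` runs from `i` to `i + q`, and `B (i + s)` from `i + s + q` to `i + s`; they
  -- cross because `s < q`.
  have hmeet : ∀ z : Fin (m - 2 * q) × Fin q, ∃ x, x ∈ (F ⟨z.1, by omega⟩).support ∧
      x ∈ (B ⟨z.1 + z.2, by omega⟩).support := by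
    rintro ⟨i, s⟩
    obtain ⟨hG₁, hG₂⟩ := exists_disjoint_walks hm hq hk hk' (i := i) (j := i + q)
      (i' := i + s + q) (j' := i + s) (by omega) (by omega) (by omega) (by omega) (by omega)
      (by omega) (by omega) (by omega)
    exact hord.exists_mem_support (by simp; omega) (by simp; omega) (by simp; omega)
      (by simp; omega) (by simp; omega) (by simp; omega) hG₁ hG₂ _ _
  choose x hxF hxB using hmeet
  -- A common vertex determines its walk in each family, hence `i` and `i + s`.
  have hinj : Function.Injective x := by
    rintro ⟨i, s⟩ ⟨i', s'⟩ h
    have h1 := hdisj 1 (Or.inl rfl) _ _ _ _ (by omega) (by omega) (by omega) (by omega)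
      (by push_cast; ring) (by push_cast; ring) _ _ (hF ⟨i, by omega⟩) (hF ⟨i', by omega⟩) _
      (hxF (i, s)) (h ▸ hxF (i', s'))
    have h2 := hdisj (-1) (Or.inr rfl) _ _ _ _ (by omega) (by omega) (by omega) (by omega)
      (by push_cast; ring) (by push_cast; ring) _ _ (hB ⟨i + s, by omega⟩)
      (hB ⟨i' + s', by omega⟩) _ (hxB (i, s)) (h ▸ hxB (i', s'))
    dsimp only at h1 h2
    exact Prod.ext (Fin.ext h1) (Fin.ext (by dsimp only; omega))
  simpa using Fintype.card_le_of_injective x hinj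

end

end Grid

/-! ### Choice of the parameters -/

theorem theorem3p2 :
    ∃ c : ℝ, 0 < c ∧
      ∀ (k : ℕ) (ε : ℝ), 2 ≤ k → 4 / (k : ℝ) < ε → ε < 1 →
        ∃ (V : Type) (_ : Fintype V) (G : PlanarInstance (Fin k) V),
          G.IsOneHole ∧ (∀ e ∈ G.graph.edgeSet, 0 < G.weight e) ∧
          ∀ (V' : Type) (_ : Fintype V') (G' : PlanarInstance (Fin k) V'),
            PlanarInstance.IsAlignedEmulator ε G' G →
              c * ((k : ℝ) / ε) ≤ (Fintype.card V' : ℝ) := by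
  -- `256 = 4 * 64`, from `m - 2 * q ≥ k / 4` and `q ≥ 1 / (64 * ε)`.
  refine ⟨1 / 256, by norm_num, fun k ε hk2 hε hε1 => ?_⟩
  have hk0 : (0 : ℝ) < k := by exact_mod_cast (by omega : 0 < k)
  have hε0 : 0 < ε := lt_trans (by positivity) hε
  have hkε : 4 < k * ε := by rwa [div_lt_iff₀ hk0, mul_comm] at hε
  have hk4 : 4 < k := by
    have : (4 : ℝ) < k := by nlinarith
    exact_mod_cast this
  have hm : 0 < k / 2 := by omega
  -- The maximum only keeps the grid nondegenerate when `ε > 1 / 32`; there the `k` terminals alone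
  -- give the bound.
  have hq : 0 < max 1 ⌊1 / (32 * ε)⌋₊ := by positivity
  have hk : k ≤ 2 * (k / 2) + 1 := by omega
  refine ⟨_, inferInstance, Grid.gridInstance hm hq hk, Grid.isOneHole hm hq hk,
    Grid.weight_pos hm hq hk, fun V' _ H hH => ?_⟩
  have hcard : (k : ℝ) ≤ Fintype.card V' := by
    have := Fintype.card_le_of_injective _ H.terminal.injective
    rw [Fintype.card_fin] at this
    exact_mod_cast this
  rw [mul_div_assoc', div_le_iff₀ hε0]
  rcases lt_or_ge (1 / 32) ε with h | h
  · nlinarith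
  · have hq1 : 1 ≤ ⌊1 / (32 * ε)⌋₊ := by
      rw [Nat.one_le_floor_iff, le_div_iff₀ (by positivity)]
      linarith
    rw [max_eq_right hq1] at hq
    have hmax : max 1 ⌊1 / (32 * ε)⌋₊ = ⌊1 / (32 * ε)⌋₊ := max_eq_right hq1
    have hle : ((max 1 ⌊1 / (32 * ε)⌋₊ : ℕ) : ℝ) ≤ 1 / (32 * ε) := by
      rw [hmax]; exact Nat.floor_le (by positivity)
    have hge : 1 / (32 * ε) < ((max 1 ⌊1 / (32 * ε)⌋₊ : ℕ) : ℝ) + 1 := by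
      rw [hmax]; exact Nat.lt_floor_add_one _
    have hone : (1 : ℝ) ≤ ((max 1 ⌊1 / (32 * ε)⌋₊ : ℕ) : ℝ) := by
      exact_mod_cast le_max_left _ _
    generalize max 1 ⌊1 / (32 * ε)⌋₊ = q at *
    rw [le_div_iff₀ (by positivity)] at hle
    rw [div_lt_iff₀ (by positivity)] at hge
    -- Here `exp (2 * ε) - 1 ≤ 4 * ε` and `q * ε ≤ 1 / 32`, so the excess is at most `1 / 2`.
    have hexp : Real.exp (2 * ε) * (4 * q) < 4 * q + 1 := by
      have := Real.abs_exp_sub_one_le (x := 2 * ε) (by rw [abs_of_pos] <;> linarith)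
      rw [abs_of_pos (by positivity : 0 < 2 * ε)] at this
      have h2 := (abs_le.1 this).2
      nlinarith
    have hmain := Grid.le_card_of_isAlignedEmulator hm _ hk (by omega) hexp hH
    have hmk : (k : ℝ) ≤ 2 * ((k / 2 : ℕ) : ℝ) + 1 := by exact_mod_cast hk
    have hk5 : (5 : ℝ) ≤ k := by exact_mod_cast hk4
    -- Combines `32 * q * ε ≤ 1` with `4 < k * ε`: the shift by `q` uses up only a small part of the
    -- width.
    have hqk : 128 * (q : ℝ) ≤ k := by
      nlinarith
    have hsub : ((k / 2 : ℕ) : ℝ) - 2 * q ≤ ((k / 2 - 2 * q : ℕ) : ℝ) := by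
      rw [sub_le_iff_le_add]
      exact_mod_cast (by omega : k / 2 ≤ k / 2 - 2 * q + 2 * q)
    have hmain' : ((k / 2 - 2 * q : ℕ) : ℝ) * q ≤ Fintype.card V' := by exact_mod_cast hmain
    have h1 : (k : ℝ) / 4 * q ≤ Fintype.card V' := by
      refine le_trans (mul_le_mul_of_nonneg_right ?_ (by linarith)) hmain'
      linarith
    have h2 : (1 : ℝ) ≤ 64 * (q * ε) := by nlinarith
    nlinarith
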